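/- **Setting.** Let $d\ge 1$ and let $\mathcal C^{(d)}$ be the space of non-empty compact subsets (particles) of $\mathbb R^d$ with the Hausdorff metric $d_H$ and its Borel $\sigma$-field. For $K\in\mathcal C^{(d)}$ let $z(K)$ be the centre of the circumscribed ball (the smallest closed ball containing $K$). Let $\mathbf N$ be the set of all measures $\xi$ on $\mathcal C^{(d)}$ with values in $\mathbb N_0\cup\{\infty\}$ that are finite on all $d_H$-balls, with the $\sigma$-field generated by the maps $\xi\mapsto\xi(A)$, $A$ Borel. For $m\ge 0$ let $\xi^{(m)}$ be the restriction of the product measure $\xi^m$ to the tuples with pairwise distinct entries ($\xi^{(0)}$ is the unit mass at the empty tuple). A particle process is a random element $\Xi$ of $\mathbf N$; throughout, $\Xi$ is stationary, almost surely non-zero and simple, i.e. almost surely $\Xi(z^{-1}(\{x\}))\in\{0,1\}$ for all $x\in\mathbb R^d$. Let $\alpha^{(q)}:=\mathbb E[\Xi^{(q)}]$ be the $q$th factorial moment measure. The $q$th Palm distributions of $\Xi$ are probability measures $\mathbb P_{K_1,\dots,K_q}$ on $\mathbf N$, depending measurably on $(K_1,\dots,K_q)$, with $$\mathbb E\Big[\int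 f(K_1,\dots,K_q,\Xi)\,\Xi^{(q)}(d(K_1,\dots,K_q))\Big]=\iint f(K_1,\dots,K_q,\xi)\,\mathbb P_{K_1,\dots,K_q}(d\xi)\,\alpha^{(q)}(d(K_1,\dots,K_q))$$ for all measurable $f\ge 0$; write $\mathbb E_{K_1,\dots,K_q}[g(\Xi)]:=\int g\,d\mathbb P_{K_1,\dots,K_q}$. **Admissible Gibbs process.** For $n\ge 2$ let $\varphi_n:(\mathcal C^{(d)})^n\to(-\infty,\infty]$ be measurable, symmetric and translation invariant, and suppose that there is $R_\varphi$ such that $\varphi_n(K_1,\dots,K_n)=0$ whenever $\max_{i<j}d_H(K_i,K_j)>R_\varphi$. Put $\kappa(K,\xi):=0$ if $K\in\operatorname{supp}\xi$ and otherwise $$\kappa(K,\xi):=\exp\Big[-\sum_{n=2}^\infty\frac1{(n-1)!}\int\varphi_n(K,L_1,\dots,L_{n-1})\,\xi^{(n-1)}(d(L_1,\dots,L_{n-1}))\Big],$$ and assume $\kappa\le 1$. Let $\mathbb Q$ be a probability measure on $\mathcal C^{(d)}$ such that, for some $R>0$, $z(K)=0$ and $K\subseteq B(0,R)$ for $\mathbb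 Q$-a.e. $K$; let $\mu:=\iint \mathbf 1\{K+x\in\cdot\}\,\mathbb Q(dK)\,dx$ and $\lambda>0$. Assume that $\Xi$ satisfies the GNZ equation $$\mathbb E\Big[\int f(K,\Xi-\delta_K)\,\Xi(dK)\Big]=\lambda\,\mathbb E\Big[\int f(K,\Xi)\,\kappa(K,\Xi)\,\mu(dK)\Big]$$ for all measurable $f\ge 0$. **Admissible U-statistic.** Let $k\ge 1$ and let $h:(\mathcal C^{(d)})^k\to\mathbb R$ be measurable, symmetric, translation invariant and bounded. Suppose that, for some $r>0$, $h(K_1,\dots,K_k)=0$ whenever $\max_{2\le i\le k}d_H(K_i,K_1)>r$ or $K_i=K_1$ for some $i\in\{2,\dots,k\}$. Put $$T(K,\xi):=\frac1{k!}\int h(K,K_2,\dots,K_k)\,\xi^{(k-1)}(d(K_2,\dots,K_k))$$ (for $k=1$: $T(K,\xi):=h(K)$). For $n\ge 1$ let $W_n:=[-\tfrac12n^{1/d},\tfrac12n^{1/d}]^d$, let $\mathcal C^d_n:=z^{-1}(W_n)$, and let $\Xi_n$ be the restriction of $\Xi$ to $\mathcal C^d_n$. **Proposition.** For every integer $p\ge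 1$, $$\sup_{n\ge 1}\ \sup_{1\le q\le p}\ \sup_{K_1,\dots,K_q\in\mathcal C^d_n}\mathbb E_{K_1,\dots,K_q}\big[\max\{|T(K_1,\Xi_n)|,1\}^p\big]<\infty,$$ where the inner supremum is an essential supremum with respect to $\alpha^{(q)}$. -/

import Mathlib

open MeasureTheory ProbabilityTheory TopologicalSpace
open scoped ENNReal

noncomputable section

namespace GibbsParticle

/-! ### Particles -/

/-- The space of particles: the non-empty compact subsets of Euclidean space of dimension `d`,
with the Hausdorff metric. -/
abbrev Particle (d : ℕ) : Type := NonemptyCompacts (EuclideanSpace ℝ (Fin d))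

instance instMeasurableSpaceParticle (d : ℕ) : MeasurableSpace (Particle d) :=
  borel (Particle d)

instance instBorelSpaceParticle (d : ℕ) : BorelSpace (Particle d) := ⟨rfl⟩

/-- The translate `K + x`. -/
def translate {d : ℕ} (x : EuclideanSpace ℝ (Fin d)) (K : Particle d) : Particle d :=
  K.map (fun y => y + x) (continuous_id.add continuous_const)

/-- The closed ball with centre `x` and radius `ρ` is the circumscribed ball of `K`, that is, a
closed ball of smallest radius among those containing `K`. -/
def IsCircumball {d : ℕ} (K : Particle d) (x : EuclideanSpace ℝ (Fin d)) (ρ : ℝ) : Prop :=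
  (K : Set (EuclideanSpace ℝ (Fin d))) ⊆ Metric.closedBall x ρ ∧
    ∀ (y : EuclideanSpace ℝ (Fin d)) (s : ℝ),
      (K : Set (EuclideanSpace ℝ (Fin d))) ⊆ Metric.closedBall y s → ρ ≤ s

theorem exists_isCircumball {d : ℕ} (K : Particle d) :
    ∃ (x : EuclideanSpace ℝ (Fin d)) (ρ : ℝ), IsCircumball K x ρ := by
  obtain ⟨k, hk⟩ := K.nonempty
  obtain ⟨s₀, hs₀⟩ := K.isCompact.isBounded.subset_closedBall k
  let S : Set (EuclideanSpace ℝ (Fin d) × ℝ) :=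
    (⋂ y ∈ (K : Set (EuclideanSpace ℝ (Fin d))), {q | dist y q.1 ≤ q.2}) ∩
      (Metric.closedBall k s₀ ×ˢ Set.Icc 0 s₀)
  have hS : IsCompact S := by
    refine IsCompact.inter_left
      ((isCompact_closedBall k s₀).prod isCompact_Icc) ?_
    refine isClosed_biInter fun y _ => ?_
    exact isClosed_le (by fun_prop) (by fun_prop)
  have hs₀' : 0 ≤ s₀ := by
    have := hs₀ hk
    simpa using this
  have hne : S.Nonempty := by
    refine ⟨(k, s₀), ?_, ?_⟩
    · simp only [Set.mem_iInter]
      intro y hy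
      exact hs₀ hy
    · exact ⟨by simpa using hs₀', hs₀', le_rfl⟩
  obtain ⟨q, hq, hmin⟩ := hS.exists_isMinOn hne (continuous_snd.continuousOn)
  refine ⟨q.1, q.2, ?_, ?_⟩
  · intro y hy
    have := hq.1
    simp only [Set.mem_iInter] at this
    exact this y hy
  · intro y s hys
    by_contra! hlt
    have hle : s ≤ s₀ := hlt.le.trans hq.2.2.2
    have hky : dist k y ≤ s := hys hk
    have hmem : (y, s) ∈ S := by
      refine ⟨?_, ?_, ?_, hle⟩
      · simp only [Set.mem_iInter]
        intro w hw
        exact hys hw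
      · rw [Metric.mem_closedBall, dist_comm]
        exact hky.trans hle
      · exact dist_nonneg.trans hky
    exact absurd (hmin hmem) (not_le.mpr hlt)

/-- The circumscribed ball is unique, so that its centre is well defined. -/
theorem IsCircumball.unique {d : ℕ} {K : Particle d} {x x' : EuclideanSpace ℝ (Fin d)}
    {ρ ρ' : ℝ} (h : IsCircumball K x ρ) (h' : IsCircumball K x' ρ') : x = x' := by
  have hρ : ρ = ρ' := le_antisymm (h.2 _ _ h'.1) (h'.2 _ _ h.1)
  subst hρ
  obtain ⟨k, hk⟩ := K.nonempty
  have hρ0 : 0 ≤ ρ := dist_nonneg.trans (h.1 hk)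
  set m : EuclideanSpace ℝ (Fin d) := (1 / 2 : ℝ) • (x + x') with hm
  have key : ∀ y ∈ (K : Set (EuclideanSpace ℝ (Fin d))),
      ‖y - m‖ ^ 2 ≤ ρ ^ 2 - ‖x - x'‖ ^ 2 / 4 := by
    intro y hy
    have h1 : ‖y - x‖ ≤ ρ := by simpa [dist_eq_norm] using h.1 hy
    have h2 : ‖y - x'‖ ≤ ρ := by simpa [dist_eq_norm] using h'.1 hy
    have hp := parallelogram_law_with_norm ℝ (y - x) (y - x')
    have e1 : (y - x) + (y - x') = (2 : ℝ) • (y - m) := by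
      rw [hm]; module
    have e2 : (y - x) - (y - x') = -(x - x') := by abel
    rw [e1, e2, norm_smul, norm_neg] at hp
    norm_num at hp
    have h1' : ‖y - x‖ ^ 2 ≤ ρ ^ 2 := by gcongr
    have h2' : ‖y - x'‖ ^ 2 ≤ ρ ^ 2 := by gcongr
    nlinarith
  have h0 : 0 ≤ ρ ^ 2 - ‖x - x'‖ ^ 2 / 4 := (sq_nonneg _).trans (key k hk)
  have hle : ρ ≤ Real.sqrt (ρ ^ 2 - ‖x - x'‖ ^ 2 / 4) := by
    refine h.2 m _ fun y hy => ?_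
    rw [Metric.mem_closedBall, dist_eq_norm]
    exact Real.le_sqrt_of_sq_le (key y hy)
  have hsq : ρ ^ 2 ≤ ρ ^ 2 - ‖x - x'‖ ^ 2 / 4 := by
    calc ρ ^ 2 ≤ Real.sqrt (ρ ^ 2 - ‖x - x'‖ ^ 2 / 4) ^ 2 := by gcongr
      _ = _ := Real.sq_sqrt h0
  have hz : ‖x - x'‖ = 0 := by
    have := sq_nonneg ‖x - x'‖
    exact pow_eq_zero_iff (two_ne_zero) |>.mp (by linarith)
  exact sub_eq_zero.mp (norm_eq_zero.mp hz)

/-- The centre `z(K)` of the circumscribed ball of `K`. -/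
def center {d : ℕ} (K : Particle d) : EuclideanSpace ℝ (Fin d) :=
  (exists_isCircumball K).choose

/-! ### Configurations and particle processes -/

/-- `ξ` takes values in `{0, 1, 2, …, ∞}` and is finite on all balls. -/
def IsConfig {d : ℕ} (ξ : Measure (Particle d)) : Prop :=
  (∀ A : Set (Particle d), MeasurableSet A → ξ A = ∞ ∨ ∃ m : ℕ, ξ A = m) ∧
    ∀ (K : Particle d) (r : ℝ), ξ (Metric.closedBall K r) < ∞

/-- The space of configurations. As a subtype of the space of measures it carries the smallest
σ-field for which all the evaluations `ξ ↦ ξ A`, with `A` Borel, are measurable. -/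
abbrev Config (d : ℕ) : Type := {ξ : Measure (Particle d) // IsConfig ξ}

/-- The `m`-th factorial measure of `ξ`: the `m`-fold product measure, restricted to the tuples
with pairwise distinct entries. For `m = 0` it is the unit mass at the empty tuple. -/
def factorialMeasure {d : ℕ} (m : ℕ) (ξ : Measure (Particle d)) :
    Measure (Fin m → Particle d) :=
  (Measure.pi fun _ : Fin m => ξ).restrict {K | Function.Injective K}

/-- `Ξ`, defined on the probability space `(Ω, P)`, is a simple stationary particle process which
almost surely is not the zero measure. Simplicity means that no two particles (counted with
multiplicity) have the same centre. -/
structure IsParticleProcess {d : ℕ} {Ω : Type*} [MeasurableSpace Ω] (P : Measure Ω)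
    (Ξ : Ω → Config d) : Prop where
  measurable : Measurable Ξ
  stationary : ∀ x : EuclideanSpace ℝ (Fin d),
    IdentDistrib (fun ω => Measure.map (translate x) (Ξ ω : Measure (Particle d)))
      (fun ω => (Ξ ω : Measure (Particle d))) P P
  simple : ∀ᵐ ω ∂P, ∀ x : EuclideanSpace ℝ (Fin d),
    (Ξ ω : Measure (Particle d)) ((fun K : Particle d => center K) ⁻¹' {x}) = 0 ∨
      (Ξ ω : Measure (Particle d)) ((fun K : Particle d => center K) ⁻¹' {x}) = 1
  ne_zero : ∀ᵐ ω ∂P, (Ξ ω : Measure (Particle d)) ≠ 0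

/-- The `m`-th factorial moment measure `E[Ξ^(m)]`. -/
def factorialMomentMeasure {d : ℕ} {Ω : Type*} [MeasurableSpace Ω] (P : Measure Ω)
    (Ξ : Ω → Config d) (m : ℕ) : Measure (Fin m → Particle d) :=
  P.bind fun ω => factorialMeasure m (Ξ ω : Measure (Particle d))

/-- `Q` is (a version of) the family of `m`-th Palm distributions of `Ξ`. -/
def IsPalm {d : ℕ} {Ω : Type*} [MeasurableSpace Ω] (P : Measure Ω) (Ξ : Ω → Config d) (m : ℕ)
    (Q : Kernel (Fin m → Particle d) (Config d)) : Prop :=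
  IsMarkovKernel Q ∧
    ∀ f : (Fin m → Particle d) × Config d → ℝ≥0∞, Measurable f →
      ∫⁻ ω, ∫⁻ K, f (K, Ξ ω) ∂(factorialMeasure m (Ξ ω : Measure (Particle d))) ∂P
        = ∫⁻ K, ∫⁻ ξ, f (K, ξ) ∂(Q K) ∂(factorialMomentMeasure P Ξ m)

/-! ### Admissible Gibbs processes -/

/-- The particle distribution `Q` is carried by the particles with centre at the origin that are
contained in the ball of radius `R` around the origin. -/
structure IsBoundedParticleDistribution {d : ℕ} (Q : Measure (Particle d)) (R : ℝ) : Prop where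
  prob : IsProbabilityMeasure Q
  centered : ∀ᵐ (K : Particle d) ∂Q, center K = 0
  bounded : ∀ᵐ (K : Particle d) ∂Q, (K : Set (EuclideanSpace ℝ (Fin d))) ⊆ Metric.closedBall 0 R

/-- The measure `μ = ∬ 1{K + x ∈ ·} Q(dK) dx`. -/
def particleIntensity {d : ℕ} (Q : Measure (Particle d)) : Measure (Particle d) :=
  Measure.map (fun a : Particle d × EuclideanSpace ℝ (Fin d) => translate a.2 a.1)
    (Q.prod volume)

/-- A family of higher-order interaction potentials `φ n`, `n ≥ 2` (the functions `φ 0` and `φ 1`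
play no role), with values in `(-∞, ∞]` and with finite interaction range `Rφ`. -/
structure IsPotential {d : ℕ} (φ : (n : ℕ) → (Fin n → Particle d) → EReal) (Rφ : ℝ) :
    Prop where
  measurable : ∀ n, 2 ≤ n → Measurable (φ n)
  ne_bot : ∀ n, 2 ≤ n → ∀ K, φ n K ≠ ⊥
  symm : ∀ n, 2 ≤ n → ∀ (σ : Equiv.Perm (Fin n)) (K : Fin n → Particle d),
    φ n (fun i => K (σ i)) = φ n K
  translation_invariant : ∀ n, 2 ≤ n →
    ∀ (x : EuclideanSpace ℝ (Fin d)) (K : Fin n → Particle d),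
      φ n (fun i => translate x (K i)) = φ n K
  finite_range : ∀ n, 2 ≤ n → ∀ K : Fin n → Particle d,
    (∃ i j, Rφ < dist (K i) (K j)) → φ n K = 0

/-- The sum over `n ≥ 2` of `1/(n-1)!` times the integral of the positive part of
`φ n (K, ·)` with respect to the factorial measure of order `n - 1`; here `n = m + 2`. -/
def positiveEnergy {d : ℕ} (φ : (n : ℕ) → (Fin n → Particle d) → EReal) (K : Particle d)
    (ξ : Measure (Particle d)) : ℝ≥0∞ :=
  ∑' m : ℕ, ((m + 1).factorial : ℝ≥0∞)⁻¹ *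
    ∫⁻ L, (φ (m + 2) (Fin.cons K L)).toENNReal ∂(factorialMeasure (m + 1) ξ)

/-- The same sum for the negative parts. -/
def negativeEnergy {d : ℕ} (φ : (n : ℕ) → (Fin n → Particle d) → EReal) (K : Particle d)
    (ξ : Measure (Particle d)) : ℝ≥0∞ :=
  ∑' m : ℕ, ((m + 1).factorial : ℝ≥0∞)⁻¹ *
    ∫⁻ L, (-φ (m + 2) (Fin.cons K L)).toENNReal ∂(factorialMeasure (m + 1) ξ)

open Classical in
/-- The series `∑_{n ≥ 2} 1/(n-1)! ∫ φ n (K, L) ξ^(n-1)(dL)` with values in `(-∞, ∞]`, set to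
zero if the negative part diverges. (For a configuration `ξ` and potentials of finite range only
finitely many tuples contribute and the negative part never diverges.) -/
def localEnergy {d : ℕ} (φ : (n : ℕ) → (Fin n → Particle d) → EReal) (K : Particle d)
    (ξ : Measure (Particle d)) : EReal :=
  if negativeEnergy φ K ξ = ∞ then 0
  else (positiveEnergy φ K ξ : EReal) - (negativeEnergy φ K ξ : EReal)

open Classical in
/-- The Papangelou intensity `κ(K, ξ)` of the potentials `φ`: zero if `K` lies in the support of
the configuration `ξ` (that is, if `K` is an atom of `ξ`), and the exponential of minus the local
energy otherwise, with `exp(-∞) = 0`. -/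
def papangelou {d : ℕ} (φ : (n : ℕ) → (Fin n → Particle d) → EReal) (K : Particle d)
    (ξ : Measure (Particle d)) : ℝ≥0∞ :=
  if ξ {K} ≠ 0 then 0 else (-localEnergy φ K ξ).exp

/-- The GNZ equation with intensity `κ`, activity `lam` and reference measure `μ`. The test
functions are defined for all pairs of a particle and a measure; only their values at
configurations matter. -/
def SatisfiesGNZ {d : ℕ} {Ω : Type*} [MeasurableSpace Ω] (P : Measure Ω) (Ξ : Ω → Config d)
    (κ : Particle d → Measure (Particle d) → ℝ≥0∞) (lam : ℝ) (μ : Measure (Particle d)) :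
    Prop :=
  ∀ f : Particle d × Measure (Particle d) → ℝ≥0∞, Measurable f →
    ∫⁻ ω, ∫⁻ K, f (K, (Ξ ω : Measure (Particle d)) - Measure.dirac K)
        ∂(Ξ ω : Measure (Particle d)) ∂P
      = ENNReal.ofReal lam *
        ∫⁻ ω, ∫⁻ K, f (K, (Ξ ω : Measure (Particle d))) *
          κ K (Ξ ω : Measure (Particle d)) ∂μ ∂P

/-- `Ξ` is an admissible Gibbs process with potentials `φ` of finite interaction range `Rφ`,
activity `lam`, and particle distribution `Q` carried by particles of size at most `R`. -/
structure IsAdmissibleGibbs {d : ℕ} {Ω : Type*} [MeasurableSpace Ω] (P : Measure Ω)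
    (Ξ : Ω → Config d) (φ : (n : ℕ) → (Fin n → Particle d) → EReal) (Rφ : ℝ)
    (Q : Measure (Particle d)) (R : ℝ) (lam : ℝ) : Prop where
  process : IsParticleProcess P Ξ
  potential : IsPotential φ Rφ
  papangelou_le_one : ∀ (K : Particle d) (ξ : Config d),
    papangelou φ K (ξ : Measure (Particle d)) ≤ 1
  radius_pos : 0 < R
  particles : IsBoundedParticleDistribution Q R
  activity_pos : 0 < lam
  gnz : SatisfiesGNZ P Ξ (papangelou φ) lam (particleIntensity Q)

/-! ### U-statistics -/

/-- `h`, a function of `k = m + 1` particles, defines a bounded admissible U-statistic function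
of order `k` with interaction bound `r`. -/
structure IsAdmissibleKernel {d : ℕ} (m : ℕ) (h : (Fin (m + 1) → Particle d) → ℝ) (r : ℝ) :
    Prop where
  measurable : Measurable h
  symm : ∀ (σ : Equiv.Perm (Fin (m + 1))) (K : Fin (m + 1) → Particle d),
    h (fun i => K (σ i)) = h K
  translation_invariant : ∀ (x : EuclideanSpace ℝ (Fin d)) (K : Fin (m + 1) → Particle d),
    h (fun i => translate x (K i)) = h K
  radius_pos : 0 < r
  eq_zero_of_far : ∀ K : Fin (m + 1) → Particle d,
    (∃ i, i ≠ 0 ∧ r < dist (K i) (K 0)) → h K = 0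
  eq_zero_of_eq : ∀ K : Fin (m + 1) → Particle d, (∃ i, i ≠ 0 ∧ K i = K 0) → h K = 0
  bounded : ∃ C : ℝ, ∀ K, |h K| ≤ C

/-- The score function
`T(K, ξ) = 1/k! ∫ h(K, K_2, …, K_k) ξ^(k-1)(d(K_2, …, K_k))` with `k = m + 1`. -/
def score {d : ℕ} {m : ℕ} (h : (Fin (m + 1) → Particle d) → ℝ) (K : Particle d)
    (ξ : Measure (Particle d)) : ℝ :=
  ((m + 1).factorial : ℝ)⁻¹ * ∫ L, h (Fin.cons K L) ∂(factorialMeasure m ξ)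

/-- The centred cube `W_n = [-n^(1/d)/2, n^(1/d)/2]^d`. -/
def window (d n : ℕ) : Set (EuclideanSpace ℝ (Fin d)) :=
  {x | ∀ i, x i ∈ Set.Icc (-((n : ℝ) ^ (1 / (d : ℝ)) / 2)) ((n : ℝ) ^ (1 / (d : ℝ)) / 2)}

/-- The particles with centre in `W_n`. -/
def windowParticles (d n : ℕ) : Set (Particle d) := center ⁻¹' window d n

end GibbsParticle

end

open GibbsParticle

/-!
The Palm moments are bounded because a Gibbs process with `κ ≤ 1` is dominated, in the sense of
correlation functions, by a Poisson process with intensity `lam * μ`, also after conditioning on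
finitely many of its particles.

By finite range and boundedness of the kernel, the score at `K₁` is at most a constant times
`Ξ(B)^(k-1)`, where `B` is the ball of radius `r` around `K₁` in the space of particles; restricting
`Ξ` to a window can only decrease this bound (`max_score_pow_le`). It remains to bound the moments
of `1 + Ξ(B)` under the Palm distributions. By the defining equation of the latter, and as the
factorial moment measures are σ-finite, this amounts to the inequality
`E ∫ 1_A(K) (1 + Ξ(B))^N Ξ^(q)(dK) ≤ C * E Ξ^(q)(A)` for all measurable sets `A` of `q`-tuples
(`IsAdmissibleGibbs.palm_moment_le`).

The inequality is proved by induction on `N` (`lintegral_section_pow_le`). One factor `1 + Ξ(B)` is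
written as a sum over the particles `L` of `Ξ` in `B`. At most `q` of these are entries of `K`, as
`Ξ` is simple, which gives `1 + q` times the moment of order `N`. For the others, the GNZ equation
replaces the sum over `L` by an integral with respect to `lam * κ * μ`, at most `lam * μ`; as `μ(B)`
is bounded uniformly in the centre of `B` (`particleIntensity_closedBall_le`), this is again a
multiple of the moment of order `N`. The same induction with `q = 0` shows that the factorial moment
measures are locally finite.

The GNZ equation is stated for test functions that are measurable on the space of all measures. The
kernels `configKernel` and `factorialKernel`, which agree with the identity and with
`factorialMeasure` on the measures that are finite on balls, serve to define such test functions.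
-/

noncomputable section

namespace GibbsParticle

/-! ### Integrals that depend measurably on the measure -/

section Kernels

variable {α : Type*} [MeasurableSpace α]

open Classical in
/-- The kernel that restricts a measure to `A` if it is finite there, and returns `0` otherwise. -/
def truncKernel (A : Set α) (hA : MeasurableSet A) : Kernel (Measure α) α :=
  Kernel.piecewise (s := {ξ : Measure α | ξ A < ∞})
    (measurableSet_lt (Measure.measurable_coe hA) measurable_const)
    (Kernel.restrict (⟨id, measurable_id⟩ : Kernel (Measure α) α) hA) 0

theorem truncKernel_apply {A : Set α} (hA : MeasurableSet A) {ξ : Measure α} (h : ξ A < ∞) :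
    truncKernel A hA ξ = ξ.restrict A := by
  classical
  rw [truncKernel, Kernel.piecewise_apply, if_pos (show ξ ∈ {ξ : Measure α | ξ A < ∞} from h),
    Kernel.restrict_apply]
  rfl

theorem truncKernel_univ_le {A : Set α} (hA : MeasurableSet A) (ξ : Measure α) :
    truncKernel A hA ξ Set.univ ≤ ξ A := by
  classical
  rw [truncKernel, Kernel.piecewise_apply]
  split_ifs
  · rw [Kernel.restrict_apply, Measure.restrict_apply_univ]
    rfl
  · simp

theorem truncKernel_eq_zero {A : Set α} (hA : MeasurableSet A) {ξ : Measure α} (h : ξ A = ∞) :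
    truncKernel A hA ξ = 0 := by
  classical
  rw [truncKernel, Kernel.piecewise_apply, if_neg]
  · rfl
  · simp [h]

/-- The total masses of `truncKernel` are finite but unbounded; cutting the space of measures
according to the integer part of the mass of `A` exhibits the kernel as a sum of finite kernels. -/
instance (A : Set α) (hA : MeasurableSet A) : IsSFiniteKernel (truncKernel A hA) := by
  classical
  let s : ℕ → Set (Measure α) := fun k => {ξ | ⌊(ξ A).toNNReal⌋₊ = k}
  have hs : ∀ k, MeasurableSet (s k) := fun k =>
    (Nat.measurable_floor.comp
      (Measure.measurable_coe hA).ennreal_toNNReal) (measurableSet_singleton k)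
  have key : truncKernel A hA =
      Kernel.sum fun k => Kernel.piecewise (hs k) (truncKernel A hA) 0 := by
    ext ξ B hB
    rw [Kernel.sum_apply' _ _ hB, tsum_eq_single ⌊(ξ A).toNNReal⌋₊]
    · rw [Kernel.piecewise_apply, if_pos (show ξ ∈ s _ from rfl)]
    · intro k hk
      rw [Kernel.piecewise_apply, if_neg fun h => hk h.symm]
      rfl
  rw [key]
  refine Kernel.isSFiniteKernel_sum (hκs := fun k => ?_)
  have : IsFiniteKernel (Kernel.piecewise (hs k) (truncKernel A hA) 0) := by
    refine ⟨⟨(k + 1 : ℕ), by simp, fun ξ => ?_⟩⟩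
    rw [Kernel.piecewise_apply]
    split_ifs with h
    · by_cases hfin : ξ A = ∞
      · simp [truncKernel_eq_zero hA hfin]
      · refine (truncKernel_univ_le hA ξ).trans ?_
        rw [← ENNReal.coe_toNNReal hfin]
        have h' : ⌊(ξ A).toNNReal⌋₊ = k := h
        have := (Nat.lt_floor_add_one (ξ A).toNNReal).le
        rw [h'] at this
        exact_mod_cast this
    · simp
  infer_instance

/-- For an increasing exhaustion `A` of the space, the kernel that returns a measure unchanged if it
is finite on every `A n`, and a σ-finite minorant of it otherwise. It makes integrals against a
measure depend measurably on that measure. -/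
def locallyFinitePart (A : ℕ → Set α) (hA : ∀ n, MeasurableSet (A n)) : Kernel (Measure α) α :=
  Kernel.sum fun n => truncKernel (disjointed A n) (MeasurableSet.disjointed hA n)

instance (A : ℕ → Set α) (hA : ∀ n, MeasurableSet (A n)) :
    IsSFiniteKernel (locallyFinitePart A hA) := by
  rw [locallyFinitePart]; infer_instance

theorem locallyFinitePart_apply {A : ℕ → Set α} (hA : ∀ n, MeasurableSet (A n))
    (hU : ⋃ n, A n = Set.univ) {ξ : Measure α} (h : ∀ n, ξ (A n) < ∞) :
    locallyFinitePart A hA ξ = ξ := by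
  have h1 : ∀ n, truncKernel (disjointed A n) (MeasurableSet.disjointed hA n) ξ
      = ξ.restrict (disjointed A n) := fun n =>
    truncKernel_apply _ ((measure_mono (disjointed_subset A n)).trans_lt (h n))
  rw [locallyFinitePart, Kernel.sum_apply]
  simp_rw [h1]
  rw [← Measure.restrict_iUnion (disjoint_disjointed A) (MeasurableSet.disjointed hA),
    iUnion_disjointed, hU, Measure.restrict_univ]

/-- The `q`-fold product of a kernel with itself, as a kernel into tuples. -/
def powKernel {X : Type*} [MeasurableSpace X] (κ : Kernel X α) :
    (q : ℕ) → Kernel X (Fin q → α)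
  | 0 => Kernel.const X (Measure.dirac Fin.elim0)
  | q + 1 => (κ ×ₖ powKernel κ q).map (MeasurableEquiv.piFinSuccAbove (fun _ => α) 0).symm

instance {X : Type*} [MeasurableSpace X] (κ : Kernel X α) [IsSFiniteKernel κ] (q : ℕ) :
    IsSFiniteKernel (powKernel κ q) := by
  induction q with
  | zero => rw [powKernel]; infer_instance
  | succ q ih => rw [powKernel]; infer_instance

theorem powKernel_apply {X : Type*} [MeasurableSpace X] (κ : Kernel X α) [IsSFiniteKernel κ]
    (x : X) [SigmaFinite (κ x)] (q : ℕ) :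
    powKernel κ q x = Measure.pi fun _ => κ x := by
  induction q with
  | zero =>
    rw [powKernel, Kernel.const_apply, Measure.pi_of_empty]
    congr 1
  | succ q ih =>
    rw [powKernel, Kernel.map_apply _ (MeasurableEquiv.measurable _), Kernel.prod_apply, ih]
    exact (measurePreserving_piFinSuccAbove (fun _ : Fin (q + 1) => κ x) 0).symm.map_eq

theorem pi_mono_measure {ι : Type*} [Fintype ι] {μ ν : ι → Measure α} (h : ∀ i, μ i ≤ ν i) :
    Measure.pi μ ≤ Measure.pi ν := by
  refine Measure.le_iff.2 fun s hs => ?_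
  have key : OuterMeasure.pi (fun i => (μ i).toOuterMeasure)
      ≤ OuterMeasure.pi (fun i => (ν i).toOuterMeasure) := by
    refine OuterMeasure.le_pi.2 fun t _ => (OuterMeasure.pi_pi_le _ t).trans ?_
    exact Finset.prod_le_prod' fun i _ => h i (t i)
  rw [Measure.pi, Measure.pi, toMeasure_apply _ _ hs, toMeasure_apply _ _ hs]
  exact key s

end Kernels

/-! ### Factorial measures of locally finite measures -/

section Configurations

variable {d : ℕ}

/-- The balls of integer radius around the particle `{0}`. -/
def exhaustion (d n : ℕ) : Set (Particle d) := Metric.closedBall {0} n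

theorem measurableSet_exhaustion (n : ℕ) : MeasurableSet (exhaustion d n) :=
  Metric.isClosed_closedBall.measurableSet

theorem iUnion_exhaustion : ⋃ n, exhaustion d n = Set.univ :=
  Metric.iUnion_closedBall_nat _

theorem exhaustion_mono : Monotone (exhaustion d) := fun _ _ h =>
  Metric.closedBall_subset_closedBall (by exact_mod_cast h)

/-- The measure `ξ` is finite on all balls. -/
def FiniteOnBalls (ξ : Measure (Particle d)) : Prop :=
  ∀ (K : Particle d) (r : ℝ), ξ (Metric.closedBall K r) < ∞

theorem FiniteOnBalls.mono {ξ η : Measure (Particle d)} (h : FiniteOnBalls ξ) (hle : η ≤ ξ) :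
    FiniteOnBalls η := fun K r => (hle _).trans_lt (h K r)

theorem FiniteOnBalls.sigmaFinite {ξ : Measure (Particle d)} (h : FiniteOnBalls ξ) :
    SigmaFinite ξ :=
  ⟨⟨⟨exhaustion d, fun _ => trivial, fun _ => h _ _, iUnion_exhaustion⟩⟩⟩

/-- The kernel that returns a measure on the space of particles unchanged if it is finite on all
balls. -/
def configKernel (d : ℕ) : Kernel (Measure (Particle d)) (Particle d) :=
  locallyFinitePart (exhaustion d) measurableSet_exhaustion

instance : IsSFiniteKernel (configKernel d) := by
  rw [configKernel]; infer_instance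

theorem configKernel_apply {ξ : Measure (Particle d)} (h : FiniteOnBalls ξ) :
    configKernel d ξ = ξ :=
  locallyFinitePart_apply _ iUnion_exhaustion fun _ => h _ _

theorem measurableSet_injective (q : ℕ) :
    MeasurableSet {K : Fin q → Particle d | Function.Injective K} := by
  have : {K : Fin q → Particle d | Function.Injective K}
      = ⋂ (i : Fin q) (j : Fin q) (_ : i ≠ j), {K | K i = K j}ᶜ := by
    ext K
    simp only [Set.mem_ofPred_eq, Set.mem_iInter, Set.mem_compl_iff]
    exact ⟨fun h i j hij hK => hij (h hK), fun h i j hK => by_contra fun hij => h i j hij hK⟩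
  rw [this]
  refine MeasurableSet.iInter fun i => MeasurableSet.iInter fun j =>
    MeasurableSet.iInter fun _ => ?_
  exact (measurableSet_eq_fun (measurable_pi_apply i) (measurable_pi_apply j)).compl

/-- The factorial measure as a kernel; it agrees with `factorialMeasure` on the measures that are
finite on all balls. -/
def factorialKernel (d q : ℕ) : Kernel (Measure (Particle d)) (Fin q → Particle d) :=
  (powKernel (configKernel d) q).restrict (measurableSet_injective q)

instance (q : ℕ) : IsSFiniteKernel (factorialKernel d q) := by
  rw [factorialKernel]; infer_instance

theorem factorialKernel_apply {ξ : Measure (Particle d)} (h : FiniteOnBalls ξ) (q : ℕ) :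
    factorialKernel d q ξ = factorialMeasure q ξ := by
  have hs : SigmaFinite (configKernel d ξ) := by
    rw [configKernel_apply h]; exact h.sigmaFinite
  rw [factorialKernel, Kernel.restrict_apply, powKernel_apply, factorialMeasure,
    configKernel_apply h]

theorem sFinite_factorialMeasure {ξ : Measure (Particle d)} (h : FiniteOnBalls ξ) (q : ℕ) :
    SFinite (factorialMeasure q ξ) := by
  rw [← factorialKernel_apply h]; infer_instance

theorem restrict_sub_dirac (ξ : Measure (Particle d)) (L : Particle d) :
    (ξ - Measure.dirac L).restrict {L}ᶜ = ξ.restrict {L}ᶜ := by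
  classical
  rw [Measure.restrict_sub_eq_restrict_sub_restrict (measurableSet_singleton L).compl,
    restrict_dirac' (measurableSet_singleton L).compl, if_neg (by simp), Measure.sub_zero]

theorem le_sub_dirac_add_one {ξ : Measure (Particle d)} {L : Particle d} (h : ξ {L} ≤ 1)
    (B : Set (Particle d)) : ξ B ≤ (ξ - Measure.dirac L) B + 1 := by
  calc ξ B ≤ ξ (B ∩ {L}ᶜ ∪ {L}) := measure_mono fun K hK => by
        by_cases hL : K = L
        · exact Or.inr hL
        · exact Or.inl ⟨hK, hL⟩
    _ ≤ ξ (B ∩ {L}ᶜ) + ξ {L} := measure_union_le _ _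
    _ = (ξ - Measure.dirac L) (B ∩ {L}ᶜ) + ξ {L} := by
        rw [← Measure.restrict_apply' (measurableSet_singleton L).compl,
          ← Measure.restrict_apply' (measurableSet_singleton L).compl, restrict_sub_dirac]
    _ ≤ _ := add_le_add (measure_mono Set.inter_subset_left) h

/-- Removing the particle `L` from a configuration does not affect the tuples that avoid `L`. -/
theorem factorialMeasure_restrict_le {ξ : Measure (Particle d)} (hξ : FiniteOnBalls ξ)
    (L : Particle d) (q : ℕ) :
    (factorialMeasure q ξ).restrict {K | ∀ i, K i ≠ L}
      ≤ factorialMeasure q (ξ - Measure.dirac L) := by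
  have := hξ.sigmaFinite
  have hset : {K : Fin q → Particle d | ∀ i, K i ≠ L} = Set.univ.pi fun _ => {L}ᶜ := by
    ext K; simp
  have hm : MeasurableSet (Set.univ.pi fun _ : Fin q => ({L}ᶜ : Set (Particle d))) :=
    MeasurableSet.univ_pi fun _ => (measurableSet_singleton L).compl
  rw [factorialMeasure, factorialMeasure, hset, Measure.restrict_comm hm, Measure.restrict_pi_pi]
  refine Measure.restrict_mono_measure (pi_mono_measure fun _ => ?_) _
  rw [← restrict_sub_dirac]
  exact Measure.restrict_le_self

end Configurations

/-! ### The reference measure of a ball -/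

section Intensity

variable {d : ℕ}

theorem measurable_translate :
    Measurable fun a : Particle d × EuclideanSpace ℝ (Fin d) => translate a.2 a.1 := by
  -- `K + x` is the image of `K × {x}` under addition.
  have h : (fun a : Particle d × EuclideanSpace ℝ (Fin d) => translate a.2 a.1)
      = fun a => (a.1 ×ˢ ({a.2} : NonemptyCompacts (EuclideanSpace ℝ (Fin d)))).map
          (fun y => y.1 + y.2) (continuous_fst.add continuous_snd) := by
    ext a x
    change x ∈ (fun y => y + a.2) '' (a.1 : Set (EuclideanSpace ℝ (Fin d)))
      ↔ x ∈ (fun y : _ × _ => y.1 + y.2) '' ((a.1 : Set (EuclideanSpace ℝ (Fin d))) ×ˢ {a.2})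
    simp
  rw [h]
  refine Continuous.measurable ?_
  refine (continuous_fst.add continuous_snd).nonemptyCompacts_map.comp ?_
  exact (NonemptyCompacts.lipschitz_prod (α := EuclideanSpace ℝ (Fin d))
      (β := EuclideanSpace ℝ (Fin d))).continuous.comp
    (continuous_fst.prodMk (NonemptyCompacts.isometry_singleton.continuous.comp continuous_snd))

/-- A particle contained in the ball of radius `R` around the origin can be moved within Hausdorff
distance `r` of `K` only by translation vectors that lie at distance at most `R + r` from any given
point of `K`. The summand `1` leaves room for a strict inequality. -/
theorem particleIntensity_closedBall_le {Q : Measure (Particle d)} {R : ℝ}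
    (hQ : IsBoundedParticleDistribution Q R) (K : Particle d) (r : ℝ) :
    particleIntensity Q (Metric.closedBall K r)
      ≤ volume (Metric.closedBall (0 : EuclideanSpace ℝ (Fin d)) (R + r + 1)) := by
  have := hQ.prob
  rw [particleIntensity, Measure.map_apply measurable_translate
    Metric.isClosed_closedBall.measurableSet, Measure.prod_apply
    (measurable_translate Metric.isClosed_closedBall.measurableSet)]
  obtain ⟨k, hk⟩ := K.nonempty
  calc _ ≤ ∫⁻ _, volume (Metric.closedBall k (R + r + 1)) ∂Q := by
        refine lintegral_mono_ae ?_
        filter_upwards [hQ.bounded] with K' hK'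
        refine measure_mono fun x hx => ?_
        have hdist : Metric.hausdorffDist (K : Set (EuclideanSpace ℝ (Fin d)))
            (translate x K' : Particle d) < r + 1 := by
          rw [← Metric.NonemptyCompacts.dist_eq, dist_comm]
          exact (Metric.mem_closedBall.1 hx).trans_lt (lt_add_one r)
        obtain ⟨y, ⟨y', hy', rfl⟩, hy⟩ := Metric.exists_dist_lt_of_hausdorffDist_lt hk hdist
          (Metric.hausdorffEDist_ne_top_of_nonempty_of_bounded K.nonempty
            (translate x K').nonempty K.isCompact.isBounded (translate x K').isCompact.isBounded)
        have hy0 : ‖y'‖ ≤ R := by simpa using hK' hy'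
        have h1 : dist x (y' + x) = ‖y'‖ := by simp
        rw [Metric.mem_closedBall]
        have h2 := dist_triangle x (y' + x) k
        rw [dist_comm (y' + x) k] at h2
        change dist k (y' + x) < r + 1 at hy
        linarith
    _ = _ := by
        rw [lintegral_const, measure_univ, mul_one, Measure.addHaar_closedBall_center]

end Intensity

/-! ### Splitting off one particle -/

section Moments

variable {d : ℕ} {Ω : Type*} [MeasurableSpace Ω] {P : Measure Ω} {Ξ : Ω → Config d}

theorem Config.finiteOnBalls (ξ : Config d) : FiniteOnBalls (ξ : Measure (Particle d)) := ξ.2.2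

theorem measurable_factorialMeasure (hΞ : Measurable Ξ) (q : ℕ) :
    Measurable fun ω => factorialMeasure q (Ξ ω : Measure (Particle d)) := by
  have h : (fun ω => factorialMeasure q (Ξ ω : Measure (Particle d)))
      = fun ω => factorialKernel d q (Ξ ω) := by
    funext ω
    rw [factorialKernel_apply (Ξ ω).finiteOnBalls]
  rw [h]
  exact (factorialKernel d q).measurable.comp (measurable_subtype_coe.comp hΞ)

theorem measurable_lintegral_factorialMeasure (hΞ : Measurable Ξ) {q : ℕ}
    {f : Measure (Particle d) × (Fin q → Particle d) → ℝ≥0∞} (hf : Measurable f) :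
    Measurable fun ω => ∫⁻ K, f (Ξ ω, K) ∂factorialMeasure q (Ξ ω : Measure (Particle d)) := by
  have h : (fun ω => ∫⁻ K, f (Ξ ω, K) ∂factorialMeasure q (Ξ ω : Measure (Particle d)))
      = fun ω => ∫⁻ K, f (Ξ ω, K) ∂factorialKernel d q (Ξ ω) := by
    funext ω
    rw [factorialKernel_apply (Ξ ω).finiteOnBalls]
  rw [h]
  exact (hf.lintegral_kernel_prod_right' (κ := factorialKernel d q)).comp
    (measurable_subtype_coe.comp hΞ)

/-- The number of particles in a section of `S` depends measurably on the configuration and on the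
base point of the section. -/
theorem measurable_configKernel_section {X : Type*} [MeasurableSpace X] {q : ℕ}
    {S : Set ((Fin q → Particle d) × Particle d)} (hS : MeasurableSet S)
    {u : X → Measure (Particle d)} (hu : Measurable u) {v : X → Fin q → Particle d}
    (hv : Measurable v) : Measurable fun x => configKernel d (u x) (Prod.mk (v x) ⁻¹' S) :=
  Kernel.measurable_kernel_prodMk_left (κ := (configKernel d).comap u hu)
    (t := {a | (v a.1, a.2) ∈ S}) (((hv.comp measurable_fst).prodMk measurable_snd) hS)

/-- For a particle `L` and a configuration `ξ`, the sum of `g(K) (2 + ξ(S_K))^N` over the tuples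
`K` of `q` distinct particles of `ξ` whose section `S_K` contains `L`. It is written in terms of
kernels, so as to be a measurable function on all measures and thus a test function for the GNZ
equation. -/
def extensionSum {q : ℕ} (S : Set ((Fin q → Particle d) × Particle d))
    (g : (Fin q → Particle d) → ℝ≥0∞) (N : ℕ) (a : Particle d × Measure (Particle d)) : ℝ≥0∞ :=
  ∫⁻ K, S.indicator 1 (K, a.1) * (g K * (2 + configKernel d a.2 (Prod.mk K ⁻¹' S)) ^ N)
    ∂factorialKernel d q a.2

theorem measurable_extensionSum {q : ℕ} {S : Set ((Fin q → Particle d) × Particle d)}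
    (hS : MeasurableSet S) {g : (Fin q → Particle d) → ℝ≥0∞} (hg : Measurable g) (N : ℕ) :
    Measurable (extensionSum S g N) := by
  have h1 : Measurable fun b : (Particle d × Measure (Particle d)) × (Fin q → Particle d) =>
      configKernel d b.1.2 (Prod.mk b.2 ⁻¹' S) :=
    measurable_configKernel_section hS (measurable_snd.comp measurable_fst) measurable_snd
  have h2 : Measurable fun b : (Particle d × Measure (Particle d)) × (Fin q → Particle d) =>
      S.indicator (1 : (Fin q → Particle d) × Particle d → ℝ≥0∞) (b.2, b.1.1) :=
    (measurable_one.indicator hS).comp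
      (measurable_snd.prodMk (measurable_fst.comp measurable_fst))
  have h3 : Measurable fun b : (Particle d × Measure (Particle d)) × (Fin q → Particle d) =>
      (2 + configKernel d b.1.2 (Prod.mk b.2 ⁻¹' S)) ^ N := (h1.const_add 2).pow_const N
  have h4 : Measurable fun b : (Particle d × Measure (Particle d)) × (Fin q → Particle d) =>
      g b.2 := hg.comp measurable_snd
  have hF := h2.mul (h4.mul h3)
  exact hF.lintegral_kernel_prod_right'
    (κ := (factorialKernel d q).comap (Prod.snd : Particle d × Measure (Particle d) → _)
      measurable_snd)

theorem lintegral_extensionSum_le {μ : Measure (Particle d)} [SFinite μ] {ξ : Measure (Particle d)}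
    (hξ : FiniteOnBalls ξ) {q : ℕ} {S : Set ((Fin q → Particle d) × Particle d)}
    (hS : MeasurableSet S) {c : ℝ≥0∞} (hc : ∀ K, μ (Prod.mk K ⁻¹' S) ≤ c)
    {g : (Fin q → Particle d) → ℝ≥0∞} (hg : Measurable g) (N : ℕ) :
    ∫⁻ L, extensionSum S g N (L, ξ) ∂μ
      ≤ c * 2 ^ N * ∫⁻ K, g K * (1 + ξ (Prod.mk K ⁻¹' S)) ^ N ∂factorialMeasure q ξ := by
  have := hξ.sigmaFinite
  have := sFinite_factorialMeasure hξ q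
  have hn : Measurable fun K : Fin q → Particle d => ξ (Prod.mk K ⁻¹' S) :=
    measurable_measure_prodMk_left hS
  have h1 : Measurable fun K : Fin q → Particle d => g K * (1 + ξ (Prod.mk K ⁻¹' S)) ^ N :=
    hg.mul ((hn.const_add 1).pow_const N)
  have h2 : Measurable fun K : Fin q → Particle d => g K * (2 + ξ (Prod.mk K ⁻¹' S)) ^ N :=
    hg.mul ((hn.const_add 2).pow_const N)
  have h3 : Measurable fun b : Particle d × (Fin q → Particle d) =>
      S.indicator (1 : (Fin q → Particle d) × Particle d → ℝ≥0∞) (b.2, b.1) :=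
    (measurable_one.indicator hS).comp measurable_swap
  simp only [extensionSum, factorialKernel_apply hξ, configKernel_apply hξ]
  rw [lintegral_lintegral_swap (h3.mul (h2.comp measurable_snd)).aemeasurable,
    ← lintegral_const_mul _ h1]
  refine lintegral_mono fun K => ?_
  rw [lintegral_mul_const _ (by exact (measurable_one.indicator hS).comp measurable_prodMk_left)]
  have e : ∫⁻ L, S.indicator 1 (K, L) ∂μ = μ (Prod.mk K ⁻¹' S) := by
    rw [← lintegral_indicator_one (measurable_prodMk_left hS)]
    rfl
  rw [e]
  calc μ (Prod.mk K ⁻¹' S) * (g K * (2 + ξ (Prod.mk K ⁻¹' S)) ^ N)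
      ≤ c * (g K * (2 * (1 + ξ (Prod.mk K ⁻¹' S))) ^ N) := by
        refine mul_le_mul' (hc K) (mul_le_mul_right (pow_le_pow_left₀ zero_le ?_ N) _)
        rw [mul_add, mul_one]
        exact add_le_add_right (le_mul_of_one_le_left zero_le one_le_two) 2
    _ = _ := by rw [mul_pow]; ring

/-- Splitting off one factor of the power `(1 + ξ(S_K))^(N+1)` for a configuration without multiple
particles: the particles counted by that factor are either among the `q` entries of `K`, or they
extend `K` to a tuple of `q + 1` distinct particles. In the second case the integral is written in a
form to which the GNZ equation applies, as an integral against `ξ` of a function of `L` and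
`ξ - δ_L`. -/
theorem lintegral_pow_succ_le {ξ : Measure (Particle d)} (hξ : FiniteOnBalls ξ)
    (hsimple : ∀ L, ξ {L} ≤ 1) {q : ℕ} {S : Set ((Fin q → Particle d) × Particle d)}
    (hS : MeasurableSet S) {g : (Fin q → Particle d) → ℝ≥0∞} (hg : Measurable g) (N : ℕ) :
    ∫⁻ K, g K * (1 + ξ (Prod.mk K ⁻¹' S)) ^ (N + 1) ∂factorialMeasure q ξ
      ≤ (1 + q) * ∫⁻ K, g K * (1 + ξ (Prod.mk K ⁻¹' S)) ^ N ∂factorialMeasure q ξ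
        + ∫⁻ L, extensionSum S g N (L, ξ - Measure.dirac L) ∂ξ := by
  have := hξ.sigmaFinite
  have := sFinite_factorialMeasure hξ q
  have hn : Measurable fun K : Fin q → Particle d => ξ (Prod.mk K ⁻¹' S) :=
    measurable_measure_prodMk_left hS
  set S' : Set ((Fin q → Particle d) × Particle d) := S ∩ {a | ∀ i, a.1 i ≠ a.2} with hS'
  have hS'm : MeasurableSet S' := by
    refine hS.inter ?_
    have : {a : (Fin q → Particle d) × Particle d | ∀ i, a.1 i ≠ a.2}
        = ⋂ i, {a | a.1 i = a.2}ᶜ := by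
      ext a; simp
    rw [this]
    exact MeasurableSet.iInter fun i => (measurableSet_eq_fun (by fun_prop) (by fun_prop)).compl
  have hcount : ∀ K : Fin q → Particle d,
      ξ (Prod.mk K ⁻¹' S) ≤ q + ξ (Prod.mk K ⁻¹' S') := by
    intro K
    calc ξ (Prod.mk K ⁻¹' S) ≤ ξ ((⋃ i, {K i}) ∪ Prod.mk K ⁻¹' S') := by
          refine measure_mono fun L hL => ?_
          by_cases h : ∃ i, K i = L
          · obtain ⟨i, rfl⟩ := h
            exact Or.inl (Set.mem_iUnion.2 ⟨i, rfl⟩)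
          · exact Or.inr ⟨hL, fun i hi => h ⟨i, hi⟩⟩
      _ ≤ ξ (⋃ i, {K i}) + ξ (Prod.mk K ⁻¹' S') := measure_union_le _ _
      _ ≤ (∑ i, ξ {K i}) + ξ (Prod.mk K ⁻¹' S') := by
          gcongr; exact measure_iUnion_fintype_le _ _
      _ ≤ q + ξ (Prod.mk K ⁻¹' S') := by
          gcongr
          refine (Finset.sum_le_sum fun i _ => hsimple (K i)).trans ?_
          simp
  set G : (Fin q → Particle d) → ℝ≥0∞ := fun K => g K * (1 + ξ (Prod.mk K ⁻¹' S)) ^ N with hG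
  have hGm : Measurable G := hg.mul ((measurable_const.add hn).pow_const N)
  calc ∫⁻ K, g K * (1 + ξ (Prod.mk K ⁻¹' S)) ^ (N + 1) ∂factorialMeasure q ξ
      ≤ ∫⁻ K, ((1 + q) * G K + ∫⁻ L, S'.indicator 1 (K, L) * G K ∂ξ)
          ∂factorialMeasure q ξ := by
        refine lintegral_mono fun K => ?_
        have e : ∫⁻ L, S'.indicator 1 (K, L) * G K ∂ξ = ξ (Prod.mk K ⁻¹' S') * G K := by
          rw [lintegral_mul_const _ (by exact (measurable_one.indicator hS'm).comp (by fun_prop)),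
            ← lintegral_indicator_one (measurable_prodMk_left hS'm)]
          rfl
        rw [e, ← add_mul, pow_succ, ← mul_assoc, mul_comm]
        change (1 + ξ (Prod.mk K ⁻¹' S)) * G K ≤ _
        rw [add_assoc]
        exact mul_le_mul_left (add_le_add_right (hcount K) 1) _
    _ = (1 + q) * ∫⁻ K, G K ∂factorialMeasure q ξ
          + ∫⁻ L, ∫⁻ K, S'.indicator 1 (K, L) * G K ∂factorialMeasure q ξ ∂ξ := by
        rw [lintegral_add_left (hGm.const_mul _), lintegral_const_mul _ hGm,
          lintegral_lintegral_swap]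
        exact (((measurable_one.indicator hS'm).mul (hGm.comp measurable_fst))).aemeasurable
    _ ≤ _ := by
        refine add_le_add le_rfl (lintegral_mono fun L => ?_)
        have hη : FiniteOnBalls (ξ - Measure.dirac L) := hξ.mono Measure.sub_le
        simp only [extensionSum, factorialKernel_apply hη, configKernel_apply hη]
        calc ∫⁻ K, S'.indicator 1 (K, L) * G K ∂factorialMeasure q ξ
            ≤ ∫⁻ K in {K | ∀ i, K i ≠ L}, S.indicator 1 (K, L) * G K ∂factorialMeasure q ξ := by
              rw [← lintegral_indicator (by
                simp only [Set.ofPred_forall]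
                exact MeasurableSet.iInter fun i => (measurableSet_eq_fun (by fun_prop)
                  (by fun_prop)).compl)]
              refine lintegral_mono fun K => ?_
              by_cases h : ∀ i, K i ≠ L
              · rw [Set.indicator_of_mem (s := {K : Fin q → Particle d | ∀ i, K i ≠ L}) h]
                exact mul_le_mul_left (Set.indicator_le_indicator_of_subset Set.inter_subset_left
                  (fun _ => zero_le) (K, L)) (G K)
              · rw [Set.indicator_of_notMem (fun h' => h h'.2), zero_mul]
                exact zero_le
          _ ≤ ∫⁻ K, S.indicator 1 (K, L) * G K ∂factorialMeasure q (ξ - Measure.dirac L) :=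
              lintegral_mono' (factorialMeasure_restrict_le hξ L q) le_rfl
          _ ≤ _ := by
              refine lintegral_mono fun K => mul_le_mul_right (mul_le_mul_right
                (pow_le_pow_left₀ zero_le ?_ N) _) _
              calc 1 + ξ (Prod.mk K ⁻¹' S)
                  ≤ 1 + ((ξ - Measure.dirac L) (Prod.mk K ⁻¹' S) + 1) := by
                    gcongr; exact le_sub_dirac_add_one (hsimple L) _
                _ = _ := by rw [add_comm _ (1 : ℝ≥0∞), ← add_assoc, one_add_one_eq_two]

end Moments

/-! ### The induction on the order of the moment -/

section Induction

variable {d : ℕ} {Ω : Type*} [MeasurableSpace Ω] {P : Measure Ω} {Ξ : Ω → Config d}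

/-- For an intensity `κ ≤ 1` the right-hand side of the GNZ equation is at most
`lam * E ∫ f(L, Ξ) μ(dL)`. -/
theorem SatisfiesGNZ.lintegral_le {κ : Particle d → Measure (Particle d) → ℝ≥0∞} {lam : ℝ}
    {μ : Measure (Particle d)} (hgnz : SatisfiesGNZ P Ξ κ lam μ)
    (hκ : ∀ (K : Particle d) (ξ : Config d), κ K (ξ : Measure (Particle d)) ≤ 1)
    {f : Particle d × Measure (Particle d) → ℝ≥0∞} (hf : Measurable f) :
    ∫⁻ ω, ∫⁻ K, f (K, (Ξ ω : Measure (Particle d)) - Measure.dirac K)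
        ∂(Ξ ω : Measure (Particle d)) ∂P
      ≤ ENNReal.ofReal lam * ∫⁻ ω, ∫⁻ K, f (K, (Ξ ω : Measure (Particle d))) ∂μ ∂P := by
  rw [hgnz f hf]
  gcongr with ω K
  exact mul_le_of_le_one_right zero_le (hκ K (Ξ ω))

/-- Moments of the number of particles in the section `S_K`, under the `q`-th Campbell measure:
if `μ(S_K) ≤ c` for all `K`, they are bounded by the factorial moment measure itself. -/
theorem lintegral_section_pow_le {κ : Particle d → Measure (Particle d) → ℝ≥0∞} {lam : ℝ}
    {μ : Measure (Particle d)} [SFinite μ] (hΞ : Measurable Ξ)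
    (hsimple : ∀ᵐ ω ∂P, ∀ L, (Ξ ω : Measure (Particle d)) {L} ≤ 1)
    (hgnz : SatisfiesGNZ P Ξ κ lam μ)
    (hκ : ∀ (K : Particle d) (ξ : Config d), κ K (ξ : Measure (Particle d)) ≤ 1)
    {q : ℕ} {S : Set ((Fin q → Particle d) × Particle d)} (hS : MeasurableSet S)
    {c : ℝ≥0∞} (hc : ∀ K, μ (Prod.mk K ⁻¹' S) ≤ c)
    {g : (Fin q → Particle d) → ℝ≥0∞} (hg : Measurable g) (N : ℕ) :
    ∫⁻ ω, ∫⁻ K, g K * (1 + (Ξ ω : Measure (Particle d)) (Prod.mk K ⁻¹' S)) ^ N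
        ∂factorialMeasure q (Ξ ω : Measure (Particle d)) ∂P
      ≤ (∏ j ∈ Finset.range N, (1 + q + ENNReal.ofReal lam * c * 2 ^ j)) *
        ∫⁻ ω, ∫⁻ K, g K ∂factorialMeasure q (Ξ ω : Measure (Particle d)) ∂P := by
  induction N with
  | zero => simp
  | succ N ih =>
    set I : ℝ≥0∞ := ∫⁻ ω, ∫⁻ K, g K * (1 + (Ξ ω : Measure (Particle d)) (Prod.mk K ⁻¹' S)) ^ N
        ∂factorialMeasure q (Ξ ω : Measure (Particle d)) ∂P with hI
    have hmeas : Measurable fun ω => ∫⁻ K, g K *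
        (1 + (Ξ ω : Measure (Particle d)) (Prod.mk K ⁻¹' S)) ^ N
        ∂factorialMeasure q (Ξ ω : Measure (Particle d)) := by
      have h := measurable_lintegral_factorialMeasure hΞ
        (f := fun a => g a.2 * (1 + configKernel d a.1 (Prod.mk a.2 ⁻¹' S)) ^ N)
        ((hg.comp measurable_snd).mul
          ((measurable_const.add
            (measurable_configKernel_section hS measurable_fst measurable_snd)).pow_const N))
      simpa only [configKernel_apply (Config.finiteOnBalls _)] using h
    calc ∫⁻ ω, ∫⁻ K, g K * (1 + (Ξ ω : Measure (Particle d)) (Prod.mk K ⁻¹' S)) ^ (N + 1)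
          ∂factorialMeasure q (Ξ ω : Measure (Particle d)) ∂P
        ≤ ∫⁻ ω, ((1 + q) * (∫⁻ K, g K * (1 + (Ξ ω : Measure (Particle d)) (Prod.mk K ⁻¹' S)) ^ N
            ∂factorialMeasure q (Ξ ω : Measure (Particle d)))
            + ∫⁻ L, extensionSum S g N (L, (Ξ ω : Measure (Particle d)) - Measure.dirac L)
              ∂(Ξ ω : Measure (Particle d))) ∂P := by
          refine lintegral_mono_ae ?_
          filter_upwards [hsimple] with ω hω
          exact lintegral_pow_succ_le (Ξ ω).finiteOnBalls hω hS hg N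
      _ = (1 + q) * I + ∫⁻ ω, ∫⁻ L,
              extensionSum S g N (L, (Ξ ω : Measure (Particle d)) - Measure.dirac L)
              ∂(Ξ ω : Measure (Particle d)) ∂P := by
          rw [lintegral_add_left (hmeas.const_mul _), lintegral_const_mul _ hmeas]
      _ ≤ (1 + q) * I + ENNReal.ofReal lam * (c * 2 ^ N * I) := by
          gcongr
          refine (hgnz.lintegral_le hκ (measurable_extensionSum hS hg N)).trans ?_
          gcongr
          rw [hI, ← lintegral_const_mul _ hmeas]
          exact lintegral_mono fun ω => lintegral_extensionSum_le (Ξ ω).finiteOnBalls hS hc hg N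
      _ = (1 + q + ENNReal.ofReal lam * c * 2 ^ N) * I := by ring
      _ ≤ _ := by
          refine (mul_le_mul_right ih _).trans_eq ?_
          rw [Finset.prod_range_succ]
          ring

end Induction

/-! ### Moments under the Palm distributions -/

section Palm

variable {d : ℕ} {Ω : Type*} [MeasurableSpace Ω] {P : Measure Ω} {Ξ : Ω → Config d}

theorem lintegral_factorialMomentMeasure (hΞ : Measurable Ξ) {q : ℕ}
    {f : (Fin q → Particle d) → ℝ≥0∞} (hf : Measurable f) :
    ∫⁻ K, f K ∂factorialMomentMeasure P Ξ q
      = ∫⁻ ω, ∫⁻ K, f K ∂factorialMeasure q (Ξ ω : Measure (Particle d)) ∂P :=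
  Measure.lintegral_bind (measurable_factorialMeasure hΞ q).aemeasurable hf.aemeasurable

theorem IsParticleProcess.singleton_le_one (hΞ : IsParticleProcess P Ξ) :
    ∀ᵐ ω ∂P, ∀ L, (Ξ ω : Measure (Particle d)) {L} ≤ 1 := by
  filter_upwards [hΞ.simple] with ω hω L
  refine (measure_mono (t := (fun K : Particle d => center K) ⁻¹' {center L}) ?_).trans ?_
  · rintro _ rfl
    rfl
  · rcases hω (center L) with h | h <;> simp [h]

variable {φ : (n : ℕ) → (Fin n → Particle d) → EReal} {Rφ : ℝ} {Q : Measure (Particle d)}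
  {R lam : ℝ}

/-- The constant that bounds the `N`-th moment, under the `q`-th Palm distributions, of one plus the
number of particles within distance `r` of the first particle. -/
def momentBound (d : ℕ) (R lam r : ℝ) (q N : ℕ) : ℝ≥0∞ :=
  ∏ j ∈ Finset.range N, (1 + q + ENNReal.ofReal lam *
    volume (Metric.closedBall (0 : EuclideanSpace ℝ (Fin d)) (R + r + 1)) * 2 ^ j)

theorem momentBound_lt_top (d : ℕ) (R lam r : ℝ) (q N : ℕ) : momentBound d R lam r q N < ∞ := by
  refine ENNReal.prod_lt_top fun j _ => ?_
  refine ENNReal.add_lt_top.2 ⟨by simp, ENNReal.mul_lt_top (ENNReal.mul_lt_top (by simp) ?_)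
    (by simp)⟩
  exact measure_closedBall_lt_top

theorem momentBound_mono (d : ℕ) (R lam r : ℝ) {q q' : ℕ} (h : q ≤ q') (N : ℕ) :
    momentBound d R lam r q N ≤ momentBound d R lam r q' N := by
  refine Finset.prod_le_prod' fun j _ => ?_
  gcongr

/-- The factorial moments of an admissible Gibbs process are locally finite. -/
theorem IsAdmissibleGibbs.sigmaFinite_factorialMomentMeasure [IsProbabilityMeasure P]
    (hΞ : IsAdmissibleGibbs P Ξ φ Rφ Q R lam) (q : ℕ) :
    SigmaFinite (factorialMomentMeasure P Ξ q) := by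
  have := hΞ.particles.prob
  have : SFinite (particleIntensity Q) := by rw [particleIntensity]; infer_instance
  refine ⟨⟨⟨fun n => Set.univ.pi fun _ => exhaustion d n, fun _ => trivial, fun n => ?_, ?_⟩⟩⟩
  · have hB : MeasurableSet (Set.univ.pi fun _ : Fin q => exhaustion d n) :=
      MeasurableSet.univ_pi fun _ => measurableSet_exhaustion n
    -- The case of the empty tuple bounds the moments of the number of particles in a fixed ball.
    have h0 := lintegral_section_pow_le hΞ.process.measurable hΞ.process.singleton_le_one hΞ.gnz
      hΞ.papangelou_le_one (q := 0) (S := Set.univ ×ˢ exhaustion d n)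
      (MeasurableSet.univ.prod (measurableSet_exhaustion n))
      (c := volume (Metric.closedBall (0 : EuclideanSpace ℝ (Fin d)) (R + n + 1)))
      (fun K => (measure_mono fun L hL => hL.2).trans
        (particleIntensity_closedBall_le hΞ.particles _ _))
      (g := 1) measurable_one q
    have hf0 : ∀ ξ : Measure (Particle d), factorialMeasure 0 ξ = Measure.dirac Fin.elim0 := by
      intro ξ
      have : {K : Fin 0 → Particle d | Function.Injective K} = Set.univ :=
        Set.eq_univ_of_forall fun K => Function.injective_of_subsingleton K
      rw [factorialMeasure, this, Measure.restrict_univ, Measure.pi_of_empty]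
      congr 1
    have hpre : ∀ K : Fin 0 → Particle d, Prod.mk K ⁻¹' (Set.univ ×ˢ exhaustion d n)
        = exhaustion d n := fun K => by ext; simp
    simp only [hf0, hpre, Pi.one_apply, one_mul, lintegral_const, measure_univ, mul_one] at h0
    calc factorialMomentMeasure P Ξ q (Set.univ.pi fun _ => exhaustion d n)
        = ∫⁻ ω, factorialMeasure q (Ξ ω : Measure (Particle d))
            (Set.univ.pi fun _ => exhaustion d n) ∂P :=
          Measure.bind_apply hB (measurable_factorialMeasure hΞ.process.measurable q).aemeasurable
      _ ≤ ∫⁻ ω, (1 + (Ξ ω : Measure (Particle d)) (exhaustion d n)) ^ q ∂P := by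
          refine lintegral_mono fun ω => ?_
          have := (Ξ ω).finiteOnBalls.sigmaFinite
          calc _ ≤ (Measure.pi fun _ : Fin q => (Ξ ω : Measure (Particle d)))
                  (Set.univ.pi fun _ => exhaustion d n) := Measure.restrict_apply_le _ _
            _ = (Ξ ω : Measure (Particle d)) (exhaustion d n) ^ q := by
                rw [Measure.pi_pi]; simp
            _ ≤ _ := by gcongr; exact le_add_self
      _ ≤ _ := h0
      _ < ∞ := momentBound_lt_top d R lam n 0 q
  · refine Set.eq_univ_of_forall fun K => ?_
    have h : ∀ i, ∃ n, K i ∈ exhaustion d n := fun i =>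
      Set.mem_iUnion.1 (iUnion_exhaustion (d := d) ▸ Set.mem_univ (K i))
    choose n hn using h
    refine Set.mem_iUnion.2 ⟨Finset.univ.sup n, fun i _ => ?_⟩
    exact exhaustion_mono (Finset.le_sup (Finset.mem_univ i)) (hn i)

/-- The moments of the number of particles near the first of the points on which a Palm distribution
is conditioned are bounded uniformly in these points. -/
theorem IsAdmissibleGibbs.palm_moment_le [IsProbabilityMeasure P]
    (hΞ : IsAdmissibleGibbs P Ξ φ Rφ Q R lam) {q : ℕ} (hq : 1 ≤ q)
    {palm : Kernel (Fin q → Particle d) (Config d)} (hpalm : IsPalm P Ξ q palm) (r : ℝ) (N : ℕ) :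
    ∀ᵐ K ∂factorialMomentMeasure P Ξ q,
      ∫⁻ ξ : Config d, (1 + (ξ : Measure (Particle d)) (Metric.closedBall (K ⟨0, hq⟩) r)) ^ N
        ∂palm K ≤ momentBound d R lam r q N := by
  have := hΞ.particles.prob
  have : SFinite (particleIntensity Q) := by rw [particleIntensity]; infer_instance
  have := hpalm.1
  have := hΞ.sigmaFinite_factorialMomentMeasure q
  let S : Set ((Fin q → Particle d) × Particle d) := {a | dist a.2 (a.1 ⟨0, hq⟩) ≤ r}
  have hS : MeasurableSet S := measurableSet_le (by fun_prop) measurable_const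
  have hpre : ∀ K : Fin q → Particle d,
      Prod.mk K ⁻¹' S = Metric.closedBall (K ⟨0, hq⟩) r := fun K => rfl
  have hF : Measurable fun a : (Fin q → Particle d) × Config d =>
      (1 + (a.2 : Measure (Particle d)) (Metric.closedBall (a.1 ⟨0, hq⟩) r)) ^ N := by
    have h := measurable_configKernel_section hS
      (measurable_subtype_coe.comp (measurable_snd (α := Fin q → Particle d) (β := Config d)))
      measurable_fst
    simp only [Function.comp_def, configKernel_apply (Config.finiteOnBalls _), hpre] at h
    exact (measurable_const.add h).pow_const N
  refine ae_le_of_forall_setLIntegral_le_of_sigmaFinite hF.lintegral_kernel_prod_right'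
    (g := fun _ => momentBound d R lam r q N) fun A hA _ => ?_
  have hg : Measurable (A.indicator (1 : (Fin q → Particle d) → ℝ≥0∞)) :=
    measurable_one.indicator hA
  have hP := hpalm.2 (fun a => A.indicator 1 a.1 *
    (1 + (a.2 : Measure (Particle d)) (Metric.closedBall (a.1 ⟨0, hq⟩) r)) ^ N)
    ((hg.comp measurable_fst).mul hF)
  have hM := lintegral_section_pow_le hΞ.process.measurable hΞ.process.singleton_le_one hΞ.gnz
    hΞ.papangelou_le_one hS (fun K => particleIntensity_closedBall_le hΞ.particles _ _) hg N
  calc ∫⁻ K in A, (∫⁻ ξ : Config d,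
        (1 + (ξ : Measure (Particle d)) (Metric.closedBall (K ⟨0, hq⟩) r)) ^ N ∂palm K)
        ∂factorialMomentMeasure P Ξ q
      = ∫⁻ K, (∫⁻ ξ : Config d, A.indicator 1 K *
        (1 + (ξ : Measure (Particle d)) (Metric.closedBall (K ⟨0, hq⟩) r)) ^ N ∂palm K)
        ∂factorialMomentMeasure P Ξ q := by
        rw [← lintegral_indicator hA]
        refine lintegral_congr fun K => ?_
        by_cases hK : K ∈ A <;> simp [hK]
    _ ≤ momentBound d R lam r q N *
        ∫⁻ K, A.indicator 1 K ∂factorialMomentMeasure P Ξ q := by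
        rw [← hP, lintegral_factorialMomentMeasure hΞ.process.measurable hg]
        exact hM
    _ = _ := by
        rw [lintegral_indicator_one hA, setLIntegral_const]

end Palm

/-! ### The score function -/

section Score

variable {d m : ℕ} {h : (Fin (m + 1) → Particle d) → ℝ} {r : ℝ}

/-- Only tuples of particles within distance `r` of `K` contribute to the score at `K`. -/
theorem abs_score_le {C : ℝ} (hC : ∀ K, |h K| ≤ C)
    (hfar : ∀ K : Fin (m + 1) → Particle d, (∃ i, i ≠ 0 ∧ r < dist (K i) (K 0)) → h K = 0)
    (K : Particle d) (ξ : Measure (Particle d)) [SigmaFinite ξ] :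
    ENNReal.ofReal |score h K ξ|
      ≤ ENNReal.ofReal C * ξ (Metric.closedBall K r) ^ m := by
  have hB : MeasurableSet (Set.univ.pi fun _ : Fin m => Metric.closedBall K r) :=
    MeasurableSet.univ_pi fun _ => Metric.isClosed_closedBall.measurableSet
  have hint : ENNReal.ofReal |∫ L, h (Fin.cons K L) ∂factorialMeasure m ξ|
      ≤ ENNReal.ofReal C * ξ (Metric.closedBall K r) ^ m := by
    calc ENNReal.ofReal |∫ L, h (Fin.cons K L) ∂factorialMeasure m ξ|
        = ‖∫ L, h (Fin.cons K L) ∂factorialMeasure m ξ‖ₑ := by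
          rw [← Real.norm_eq_abs, ofReal_norm]
      _ ≤ ∫⁻ L, ‖h (Fin.cons K L)‖ₑ ∂factorialMeasure m ξ := enorm_integral_le_lintegral_enorm _
      _ ≤ ∫⁻ L, (Set.univ.pi fun _ => Metric.closedBall K r).indicator
            (fun _ => ENNReal.ofReal C) L ∂factorialMeasure m ξ := by
          refine lintegral_mono fun L => ?_
          by_cases hL : L ∈ Set.univ.pi fun _ => Metric.closedBall K r
          · rw [Set.indicator_of_mem hL, ← ofReal_norm, Real.norm_eq_abs]
            exact ENNReal.ofReal_le_ofReal (hC _)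
          · rw [Set.mem_univ_pi] at hL
            push Not at hL
            obtain ⟨i, hi⟩ := hL
            rw [hfar (Fin.cons K L) ⟨i.succ, Fin.succ_ne_zero i, by simpa using hi⟩]
            simp
      _ = ENNReal.ofReal C * factorialMeasure m ξ (Set.univ.pi fun _ => Metric.closedBall K r) :=
          lintegral_indicator_const hB _
      _ ≤ ENNReal.ofReal C * (Measure.pi fun _ : Fin m => ξ)
            (Set.univ.pi fun _ => Metric.closedBall K r) := by
          gcongr
          exact Measure.restrict_le_self
      _ = _ := by rw [Measure.pi_pi]; simp
  refine le_trans (ENNReal.ofReal_le_ofReal ?_) hint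
  rw [score, abs_mul]
  refine mul_le_of_le_one_left (abs_nonneg _) ?_
  rw [abs_of_nonneg (by positivity)]
  exact inv_le_one_of_one_le₀ (by exact_mod_cast Nat.one_le_iff_ne_zero.2 (Nat.factorial_ne_zero _))

/-- Restricting the configuration to a further set `W` preserves the bound on the score. -/
theorem max_score_pow_le {C : ℝ} (hC : ∀ K, |h K| ≤ C)
    (hfar : ∀ K : Fin (m + 1) → Particle d, (∃ i, i ≠ 0 ∧ r < dist (K i) (K 0)) → h K = 0)
    (K : Particle d) (ξ : Config d) (W : Set (Particle d)) (p : ℕ) :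
    ENNReal.ofReal (max |score h K ((ξ : Measure (Particle d)).restrict W)| 1 ^ p)
      ≤ (ENNReal.ofReal C + 1) ^ p *
        (1 + (ξ : Measure (Particle d)) (Metric.closedBall K r)) ^ (m * p) := by
  have := (ξ.finiteOnBalls.mono (Measure.restrict_le_self (s := W))).sigmaFinite
  rw [ENNReal.ofReal_pow (by positivity), pow_mul, ← mul_pow]
  gcongr
  rw [ENNReal.ofReal_max, ENNReal.ofReal_one, add_mul, one_mul]
  refine max_le ?_ ?_
  · refine (abs_score_le hC hfar K _).trans (le_add_right ?_)
    gcongr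
    exact (Measure.restrict_apply_le _ _).trans le_add_self
  · exact le_add_left (one_le_pow₀ le_self_add)

end Score

end GibbsParticle

end

/-! ### The uniform bound -/

theorem proposition4p3 {d : ℕ} (hd : 1 ≤ d)
    {Ω : Type*} [MeasurableSpace Ω] (P : Measure Ω) [IsProbabilityMeasure P]
    (Ξ : Ω → Config d) (φ : (n : ℕ) → (Fin n → Particle d) → EReal) (Rφ : ℝ)
    (Q : Measure (Particle d)) (R lam : ℝ)
    (hΞ : IsAdmissibleGibbs P Ξ φ Rφ Q R lam)
    (palm : (q : ℕ) → Kernel (Fin q → Particle d) (Config d))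
    (hpalm : ∀ q, 1 ≤ q → IsPalm P Ξ q (palm q))
    (m : ℕ) (h : (Fin (m + 1) → Particle d) → ℝ) (r : ℝ) (hh : IsAdmissibleKernel m h r)
    (p : ℕ) (hp : 1 ≤ p) :
    (⨆ (n : ℕ) (_ : 1 ≤ n) (q : ℕ) (hq : 1 ≤ q) (_ : q ≤ p),
      essSup
        (fun K : Fin q → Particle d =>
          ∫⁻ ξ : Config d,
            ENNReal.ofReal
              (max |score h (K ⟨0, hq⟩)
                ((ξ : Measure (Particle d)).restrict (windowParticles d n))| 1 ^ p)
            ∂(palm q K))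
        ((factorialMomentMeasure P Ξ q).restrict
          {K | ∀ i, K i ∈ windowParticles d n})) < ∞ := by
  obtain ⟨C, hC⟩ := hh.bounded
  refine lt_of_le_of_lt (b := (ENNReal.ofReal C + 1) ^ p * momentBound d R lam r p (m * p)) ?_
    (ENNReal.mul_lt_top (ENNReal.pow_lt_top (by simp)) (momentBound_lt_top _ _ _ _ _ _))
  refine iSup_le fun n => iSup_le fun _ => iSup_le fun q => iSup_le fun hq => iSup_le fun hqp => ?_
  refine (essSup_mono_measure' Measure.restrict_le_self).trans (essSup_le_of_ae_le _ ?_)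
  filter_upwards [hΞ.palm_moment_le hq (hpalm q hq) r (m * p)] with K hK
  calc _ ≤ ∫⁻ ξ : Config d, (ENNReal.ofReal C + 1) ^ p *
          (1 + (ξ : Measure (Particle d)) (Metric.closedBall (K ⟨0, hq⟩) r)) ^ (m * p)
          ∂palm q K :=
        lintegral_mono fun ξ => max_score_pow_le hC hh.eq_zero_of_far _ ξ _ p
    _ = (ENNReal.ofReal C + 1) ^ p * ∫⁻ ξ : Config d,
          (1 + (ξ : Measure (Particle d)) (Metric.closedBall (K ⟨0, hq⟩) r)) ^ (m * p)
          ∂palm q K := lintegral_const_mul' _ _ (by finiteness)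
    _ ≤ _ := by
        gcongr
        exact hK.trans (momentBound_mono d R lam r hqp _)
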